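/- All graphs are finite, simple and undirected; $\Delta(G)$ is the maximum degree of $G$, and the girth of $G$ is the length of a shortest cycle ($+\infty$ if $G$ is a forest). A graph is planar if it can be drawn in the plane with its vertices as distinct points and its edges as simple arcs that meet one another and the vertices only at their ends. Let $k\ge 0$ be an integer. A graph $H$ is \emph{group $k$-choosable} if for every orientation of its edges, every abelian group $A$ of order at least $k$, every assignment $L$ of a $k$-element subset $L(v)\subseteq A$ to each vertex $v$ of $H$, and every function $f:E(H)\to A$, there is a map $c:V(H)\to A$ with $c(v)\in L(v)$ for every vertex $v$ and $c(u)-c(v)\ne f(uv)$ for every edge $uv$ directed from $u$ to $v$. A graph $G$ is \emph{group $k$-edge-choosable} if its line graph (whose vertices are the edges of $G$, two of them being adjacent if and only if they are distinct and share an endpoint in $G$) is group $k$-choosable. \textbf{Corollary.} Every planar graph $G$ with girth at least $4$ and $\Delta(G)\ge 6$ is group $(\Delta(G)+1)$-edge-choosable. -/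

import Mathlib

universe w u

namespace SimpleGraph

/-- The Euclidean plane. -/
abbrev Plane : Type := EuclideanSpace ℝ (Fin 2)

/-- A drawing of `G` in the plane without crossings: the vertices are distinct points, every edge
is a simple arc joining the points of its two ends, no arc passes through the point of a vertex
except at its own two ends, and two different arcs can only meet at ends of these arcs. -/
structure PlaneDrawing {V : Type*} (G : SimpleGraph V) where
  /-- the point that represents a vertex -/
  point : V → Plane
  point_injective : Function.Injective point
  /-- the arc that represents an edge, as a parametrized curve -/
  arc : G.edgeSet → unitInterval → Plane
  arc_continuous : ∀ e, Continuous (arc e)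
  arc_injective : ∀ e, Function.Injective (arc e)
  arc_ends : ∀ e, s(arc e 0, arc e 1) = Sym2.map point (e : Sym2 V)
  arc_avoids : ∀ e t v, arc e t = point v → t = 0 ∨ t = 1
  arc_disjoint : ∀ e e' t t', e ≠ e' → arc e t = arc e' t' → (t = 0 ∨ t = 1) ∧ (t' = 0 ∨ t' = 1)

/-- A graph is planar if it can be drawn in the plane without crossings. -/
def IsPlanar {V : Type*} (G : SimpleGraph V) : Prop :=
  Nonempty G.PlaneDrawing

/-- An orientation of the edges of `G`: each edge `uv` is directed either from `u` to `v`
or from `v` to `u`, and not both. -/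
structure EdgeOrientation {V : Type*} (G : SimpleGraph V) where
  /-- `dir u v` says that `uv` is an edge that is directed from `u` to `v` -/
  dir : V → V → Prop
  adj_of_dir : ∀ u v, dir u v → G.Adj u v
  dir_or_dir : ∀ u v, G.Adj u v → dir u v ∨ dir v u
  not_dir_of_dir : ∀ u v, dir u v → ¬ dir v u

/-- `c` is an `(A, L, f)`-coloring of `G` under the orientation `D`: the color of each vertex is in
its list, and `c u - c v ≠ f (uv)` for every edge `uv` directed from `u` to `v`. -/
def IsGroupListColoring {V A : Type*} [AddCommGroup A] (G : SimpleGraph V) (D : G.EdgeOrientation)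
    (L : V → Finset A) (f : G.edgeSet → A) (c : V → A) : Prop :=
  (∀ v, c v ∈ L v) ∧
    ∀ u v (h : D.dir u v), c u - c v ≠ f ⟨s(u, v), D.adj_of_dir u v h⟩

/-- `G` is group `k`-choosable: for every orientation of its edges, every abelian group `A`
(finite or infinite) of order at least `k`, every `k`-uniform list assignment `L` and every
function `f : E(G) → A`, the graph has an `(A, L, f)`-coloring. The universe `w` of the groups
is arbitrary. -/
def GroupChoosable {V : Type u} (G : SimpleGraph V) (k : ℕ) : Prop :=
  ∀ (D : G.EdgeOrientation) (A : Type w) [AddCommGroup A], (k : ℕ∞) ≤ ENat.card A →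
    ∀ (L : V → Finset A), (∀ v, (L v).card = k) →
      ∀ f : G.edgeSet → A, ∃ c : V → A, G.IsGroupListColoring D L f c

/-- `G` is group `k`-edge-choosable: its line graph is group `k`-choosable. -/
def GroupEdgeChoosable {V : Type u} (G : SimpleGraph V) (k : ℕ) : Prop :=
  GroupChoosable.{w, u} G.lineGraph k

end SimpleGraph

/-! Edges are coloured greedily. A coloured neighbour in the line graph forbids just one group
element, whatever the orientation and `f`. So it suffices that every nonempty set of edges, seen as
a subgraph H, has an edge uv with d(u) + d(v) ≤ Δ + 2, which meets at most Δ others. Summing 1/d(u)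
+ 1/d(v) over the edges of H counts its non-isolated vertices. Without such a light edge every term
is at most 1/2, so H has at least twice as many edges as non-isolated vertices.

Triangle-free planar graphs are sparser than that. Instead of Euler's formula for topological faces,
`Grid.exists_isModel_of_isPlanar` turns the drawing into a minor model in the square grid, where
every cycle mod 2 is explicitly a coboundary of a function on the unit squares. Hence the cycle
space of H is spanned by face boundaries covering each edge at most twice
(`Grid.ker_incidence_le_span`). Each nonzero one has at least 4 edges, so 4 dim ≤ 2|E|. With dim ≥
|E| - |U| + 1, where U is the set of non-isolated vertices, this gives |E| ≤ 2|U| - 2. -/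

namespace SimpleGraph

/-! ### Greedy group colouring. -/

/-- A graph in which every nonempty set of vertices spans a vertex with fewer than `k` neighbours in
that set is group `k`-choosable. -/
theorem groupChoosable_of_degenerate {V : Type u} [Finite V] (G : SimpleGraph V) (k : ℕ)
    (h : ∀ S : Finset V, S.Nonempty → ∃ v ∈ S, {w | w ∈ S ∧ G.Adj v w}.ncard < k) :
    GroupChoosable.{w, u} G k := by
  classical
  intro D A _ _ L hL f
  have : Fintype V := Fintype.ofFinite V
  suffices H : ∀ n : ℕ, ∀ S : Finset V, S.card = n → ∃ c : V → A, (∀ v ∈ S, c v ∈ L v) ∧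
      ∀ u v (h : D.dir u v), u ∈ S → v ∈ S → c u - c v ≠ f ⟨s(u, v), D.adj_of_dir u v h⟩ by
    obtain ⟨c, hc, hc'⟩ := H _ Finset.univ rfl
    exact ⟨c, fun v => hc v (Finset.mem_univ _),
      fun u v h => hc' u v h (Finset.mem_univ _) (Finset.mem_univ _)⟩
  intro n
  induction n with
  | zero =>
    intro S hS
    rw [Finset.card_eq_zero] at hS
    subst hS
    exact ⟨0, by simp, by simp⟩
  | succ n ih =>
    intro S hS
    obtain ⟨v, hv, hk⟩ := h S (Finset.card_pos.mp (by omega))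
    obtain ⟨c, hc, hc'⟩ := ih (S.erase v) (by rw [Finset.card_erase_of_mem hv]; omega)
    set N : Finset V := S.filter (G.Adj v) with hN
    have hNk : N.card < k := by
      rw [← Set.ncard_coe_finset]
      simpa [hN] using hk
    -- The one colour that the coloured neighbour `w` forbids at `v`; the value 0 is a default for
    -- non-neighbours.
    let g : V → A := fun w =>
      if h : D.dir v w then c w + f ⟨s(v, w), D.adj_of_dir v w h⟩
      else if h : D.dir w v then c w - f ⟨s(w, v), D.adj_of_dir w v h⟩ else 0
    obtain ⟨a, ha, haN⟩ : ∃ a ∈ L v, a ∉ N.image g := by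
      apply Finset.exists_mem_notMem_of_card_lt_card
      rw [hL v]
      exact Finset.card_image_le.trans_lt hNk
    refine ⟨Function.update c v a, ?_, ?_⟩
    · intro w hw
      by_cases hwv : w = v
      · subst hwv; simpa using ha
      · simpa [hwv] using hc w (Finset.mem_erase.mpr ⟨hwv, hw⟩)
    · intro x y hxy hx hy
      have hadj := D.adj_of_dir x y hxy
      by_cases hxv : x = v
      · subst hxv
        have hyx : y ≠ x := hadj.ne'
        simp only [Function.update_self, Function.update_of_ne hyx]
        intro heq
        apply haN
        refine Finset.mem_image.mpr ⟨y, by simp [hN, hy, hadj], ?_⟩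
        simp only [g, hxy, dif_pos, ← heq]
        abel
      · by_cases hyv : y = v
        · subst hyv
          simp only [Function.update_self, Function.update_of_ne hxv]
          intro heq
          apply haN
          refine Finset.mem_image.mpr ⟨x, by simp [hN, hx, hadj.symm], ?_⟩
          simp only [g, hxy, dif_pos, D.not_dir_of_dir x y hxy, dif_neg, not_false_eq_true, ← heq]
          abel
        · simp only [Function.update_of_ne hxv, Function.update_of_ne hyv]
          exact hc' x y hxy (Finset.mem_erase.mpr ⟨hxv, hx⟩) (Finset.mem_erase.mpr ⟨hyv, hy⟩)

end SimpleGraph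

/-! ### Light edges in sparse graphs. -/

namespace SimpleGraph

/-- A sparse graph of maximum degree at most `D` has an edge whose ends have small degree sum. -/
theorem exists_adj_degree_add_degree_le {V : Type*} [Fintype V] (H : SimpleGraph V)
    [DecidableRel H.Adj] {D : ℕ} (hD : 6 ≤ D) (hdeg : ∀ v, H.degree v ≤ D)
    (hE : H.edgeFinset.card < 2 * {v | 0 < H.degree v}.ncard) :
    ∃ u v, H.Adj u v ∧ H.degree u + H.degree v ≤ D + 2 := by
  classical
  by_contra! hc
  let d : V → ℚ := fun v => H.degree v
  have key : ∀ u v, H.Adj u v → (d u)⁻¹ + (d v)⁻¹ ≤ 1 / 2 := by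
    -- The bounds force a ≥ 3. If a = 3 then b ≥ D ≥ 6 and 1/3 + 1/6 = 1/2; otherwise both terms are
    -- at most 1/4.
    have aux : ∀ a b : ℕ, a ≤ b → b ≤ D → D + 2 < a + b → (a : ℚ)⁻¹ + (b : ℚ)⁻¹ ≤ 1 / 2 := by
      intro a b hab hb hs
      by_cases ha : a = 3
      · have hb6 : (6 : ℚ) ≤ b := by exact_mod_cast (by omega : 6 ≤ b)
        have := inv_anti₀ (by norm_num) hb6
        subst ha
        norm_num at this ⊢
        linarith
      · have ha4 : (4 : ℚ) ≤ a := by exact_mod_cast (by omega : 4 ≤ a)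
        have hb4 : (4 : ℚ) ≤ b := by exact_mod_cast (by omega : 4 ≤ b)
        have h1 := inv_anti₀ (by norm_num) ha4
        have h2 := inv_anti₀ (by norm_num) hb4
        norm_num at h1 h2 ⊢
        linarith
    intro u v huv
    have hs := hc u v huv
    rcases le_total (H.degree u) (H.degree v) with h | h
    · exact aux _ _ h (hdeg v) hs
    · rw [add_comm]
      exact aux _ _ h (hdeg u) (by omega)
  have hrow : ∀ u, ∑ v, (if H.Adj u v then (d u)⁻¹ else 0) = if 0 < H.degree u then 1 else 0 := by
    intro u
    rw [← Finset.sum_filter, Finset.sum_const, ← neighborFinset_eq_filter, card_neighborFinset_eq_degree,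
      nsmul_eq_mul]
    split_ifs with h
    · exact mul_inv_cancel₀ (by positivity)
    · simp [d, Nat.eq_zero_of_not_pos h]
  have hU : ∑ u, ∑ v, (if H.Adj u v then (d u)⁻¹ else 0) = ({v | 0 < H.degree v}.ncard : ℚ) := by
    simp_rw [hrow]
    rw [Finset.sum_boole, ← Set.ncard_coe_finset]
    simp
  have hU' : ∑ u, ∑ v, (if H.Adj u v then (d v)⁻¹ else 0) = ({v | 0 < H.degree v}.ncard : ℚ) := by
    rw [Finset.sum_comm, ← hU]
    simp_rw [H.adj_comm]
  -- The sums run over ordered pairs: the left side is twice the number of non-isolated vertices,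
  -- the right side the number of edges.
  have hle : ∑ u, ∑ v, (if H.Adj u v then (d u)⁻¹ else 0)
      + ∑ u, ∑ v, (if H.Adj u v then (d v)⁻¹ else 0)
      ≤ ∑ u, ∑ v, (if H.Adj u v then (1 / 2 : ℚ) else 0) := by
    simp_rw [← Finset.sum_add_distrib]
    refine Finset.sum_le_sum fun u _ => Finset.sum_le_sum fun v _ => ?_
    split_ifs with h
    · exact key u v h
    · simp
  have hm : ∑ u, ∑ v, (if H.Adj u v then (1 / 2 : ℚ) else 0) = H.edgeFinset.card := by
    have : ∀ u, ∑ v, (if H.Adj u v then (1 / 2 : ℚ) else 0) = H.degree u * (1 / 2) := by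
      intro u
      rw [← Finset.sum_filter, Finset.sum_const, ← neighborFinset_eq_filter,
        card_neighborFinset_eq_degree, nsmul_eq_mul]
    simp_rw [this]
    rw [← Finset.sum_mul, ← Nat.cast_sum, H.sum_degrees_eq_twice_card_edges]
    push_cast
    ring
  rw [hU, hU', hm] at hle
  have : 2 * {v | 0 < H.degree v}.ncard ≤ H.edgeFinset.card := by
    rw [← @Nat.cast_le ℚ]
    push_cast
    linarith
  omega

/-- If all nonempty subgraphs of `G` are sparse, then `G` is group `(D + 1)`-edge-choosable for
every `D ≥ 6` that bounds the degrees. -/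
theorem groupEdgeChoosable_of_sparse {V : Type u} [Fintype V] (G : SimpleGraph V)
    [DecidableRel G.Adj] {D : ℕ} (hD : 6 ≤ D) (hdeg : ∀ v, G.degree v ≤ D)
    (hE : ∀ H ≤ G, H ≠ ⊥ → H.edgeSet.ncard < 2 * {v | ∃ w, H.Adj v w}.ncard) :
    GroupEdgeChoosable.{w, u} G (D + 1) := by
  classical
  refine groupChoosable_of_degenerate _ _ fun S hS => ?_
  obtain ⟨H, hHadj⟩ : ∃ H : SimpleGraph V, ∀ u v, H.Adj u v ↔
      ∃ h : G.Adj u v, (⟨s(u, v), h⟩ : G.edgeSet) ∈ S := by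
    refine ⟨fromEdgeSet (Subtype.val '' (S : Set G.edgeSet)), fun u v => ?_⟩
    simp only [fromEdgeSet_adj, Set.mem_image, Finset.mem_coe, Subtype.exists, exists_and_right,
      exists_eq_right, mem_edgeSet, ne_eq]
    constructor
    · rintro ⟨h, -⟩
      exact h
    · rintro ⟨h, h'⟩
      exact ⟨⟨h, h'⟩, h.ne⟩
  have hHG : H ≤ G := fun u v h => ((hHadj u v).mp h).1
  have hne : H ≠ ⊥ := by
    obtain ⟨⟨e, he⟩, heS⟩ := hS
    induction e with | _ u v
    intro h
    have : H.Adj u v := (hHadj u v).mpr ⟨he, heS⟩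
    rw [h] at this
    exact this
  have hsp := hE H hHG hne
  have hcard : H.edgeSet.ncard = H.edgeFinset.card := by
    rw [← coe_edgeFinset, Set.ncard_coe_finset]
  rw [hcard] at hsp
  obtain ⟨u, v, huv, hd⟩ := exists_adj_degree_add_degree_le H hD
    (fun v => (degree_le_of_le hHG).trans (hdeg v)) (by
      simpa only [degree_pos_iff_exists_adj] using hsp)
  obtain ⟨huvG, huvS⟩ := (hHadj u v).mp huv
  refine ⟨_, huvS, ?_⟩
  -- Removing uv itself from both incidence sets leaves at most d(u) + d(v) - 2 ≤ D neighbours.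
  have hsub : Subtype.val '' {w | w ∈ S ∧ G.lineGraph.Adj ⟨s(u, v), huvG⟩ w} ⊆
      (((H.incidenceFinset u).erase s(u, v) ∪ (H.incidenceFinset v).erase s(u, v) :
        Finset (Sym2 V)) : Set (Sym2 V)) := by
    rintro _ ⟨⟨e, he⟩, ⟨heS, hadj⟩, rfl⟩
    rw [lineGraph_adj_iff_exists] at hadj
    obtain ⟨hne, x, hx, hx'⟩ := hadj
    have heH : e ∈ H.edgeSet := by
      induction e with | _ a b
      exact (hHadj a b).mpr ⟨he, heS⟩
    have hne' : e ≠ s(u, v) := fun h => hne (Subtype.ext h.symm)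
    simp only [Sym2.mem_iff] at hx
    simp only [Finset.coe_union, Finset.coe_erase, Set.mem_union, Set.mem_sdiff, Finset.mem_coe,
      mem_incidenceFinset, Set.mem_singleton_iff, hne', not_false_eq_true, and_true, incidenceSet,
      Set.mem_ofPred_eq, heH, true_and]
    rcases hx with rfl | rfl
    · exact Or.inl hx'
    · exact Or.inr hx'
  rw [← Set.ncard_image_of_injective _ Subtype.val_injective]
  refine (Set.ncard_le_ncard hsub (Finset.finite_toSet _)).trans_lt ?_
  rw [Set.ncard_coe_finset]
  refine (Finset.card_union_le _ _).trans_lt ?_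
  have hu : 0 < H.degree u := (H.degree_pos_iff_exists_adj u).mpr ⟨v, huv⟩
  have hv : 0 < H.degree v := (H.degree_pos_iff_exists_adj v).mpr ⟨u, huv.symm⟩
  rw [Finset.card_erase_of_mem, Finset.card_erase_of_mem, card_incidenceFinset_eq_degree,
    card_incidenceFinset_eq_degree]
  · omega
  · rw [mem_incidenceFinset]; exact (mk'_mem_incidenceSet_right_iff H).mpr huv
  · rw [mem_incidenceFinset]; exact (mk'_mem_incidenceSet_left_iff H).mpr huv

end SimpleGraph

/-! ### The square grid and its cycle space over `ZMod 2`

The points of the grid are the elements of `ℤ × ℤ`; the edge `(p, false)` joins `p` to its right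
neighbour and `(p, true)` joins `p` to its upper neighbour. The unit squares are named by their lower
left corners. -/

namespace Grid

/-- The second end of a grid edge. -/
def head : (ℤ × ℤ) × Bool → ℤ × ℤ
  | (p, false) => (p.1 + 1, p.2)
  | (p, true) => (p.1, p.2 + 1)

/-- The square below a horizontal edge, and to the left of a vertical edge. The square on the other
side of `e` is `e.1`. -/
def side : (ℤ × ℤ) × Bool → ℤ × ℤ
  | (p, false) => (p.1, p.2 - 1)
  | (p, true) => (p.1 - 1, p.2)

/-- The boundary of a chain of grid edges. -/
noncomputable def boundary :
    ((ℤ × ℤ) × Bool →₀ ZMod 2) →ₗ[ZMod 2] (ℤ × ℤ →₀ ZMod 2) :=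
  Finsupp.linearCombination (ZMod 2) fun e => Finsupp.single e.1 1 + Finsupp.single (head e) 1

theorem boundary_single (e : (ℤ × ℤ) × Bool) (a : ZMod 2) :
    boundary (Finsupp.single e a) = a • (Finsupp.single e.1 1 + Finsupp.single (head e) 1) :=
  Finsupp.linearCombination_single _ _ _

theorem boundary_apply (C : (ℤ × ℤ) × Bool →₀ ZMod 2) (x y : ℤ) :
    boundary C (x, y) =
      C ((x, y), false) + C ((x - 1, y), false) + C ((x, y), true) + C ((x, y - 1), true) := by
  induction C using Finsupp.induction_linear with
  | zero => simp
  | add f g hf hg =>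
    rw [map_add, Finsupp.add_apply, hf, hg]
    simp only [Finsupp.add_apply]
    ring
  | single e a =>
    obtain ⟨⟨p, q⟩, b⟩ := e
    rw [boundary_single]
    cases b
    · have : (p + 1 = x ∧ q = y) ↔ (p = x - 1 ∧ q = y) := by omega
      simp only [head, Finsupp.smul_apply, Finsupp.add_apply, Finsupp.single_apply, Prod.mk.injEq,
        this, smul_eq_mul, and_true, Bool.false_eq_true, and_false, if_false]
      split_ifs <;> simp [mul_add]
    · have : (p = x ∧ q + 1 = y) ↔ (p = x ∧ q = y - 1) := by omega
      simp only [head, Finsupp.smul_apply, Finsupp.add_apply, Finsupp.single_apply, Prod.mk.injEq,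
        this, smul_eq_mul, and_true, Bool.true_eq_false, and_false, if_false]
      split_ifs <;> simp [mul_add]

/-- A chain that is the coboundary of a function on the squares is a cycle. -/
theorem boundary_eq_zero_of_eq_add (C : (ℤ × ℤ) × Bool →₀ ZMod 2) (s : ℤ × ℤ → ZMod 2)
    (h : ∀ e, C e = s e.1 + s (side e)) : boundary C = 0 := by
  ext ⟨x, y⟩
  rw [boundary_apply]
  simp only [h, side, Finsupp.zero_apply]
  -- Each of the four squares around a grid point is counted twice.
  linear_combination
    (s (x, y) + s (x, y - 1) + s (x - 1, y) + s (x - 1, y - 1)) * CharTwo.two_eq_zero (R := ZMod 2)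

/-- Every cycle of the grid is the coboundary of a function on the squares. -/
theorem exists_eq_add_of_boundary_eq_zero (C : (ℤ × ℤ) × Bool →₀ ZMod 2) (h : boundary C = 0) :
    ∃ s : ℤ × ℤ → ZMod 2, ∀ e, C e = s e.1 + s (side e) := by
  obtain ⟨M, hM⟩ : ∃ M : ℤ, ∀ e, e.1.1 ≤ M → C e = 0 := by
    obtain ⟨M, hM⟩ := (C.support.image fun e => e.1.1).bddBelow
    refine ⟨M - 1, fun e he => ?_⟩
    by_contra hne
    have : M ≤ e.1.1 := hM (Finset.mem_coe.mpr
      (Finset.mem_image_of_mem (fun e : (ℤ × ℤ) × Bool => e.1.1) (Finsupp.mem_support_iff.mpr hne)))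
    omega
  -- Ray parity: the vertical edges of `C` crossed on the way from the far left to the square `p`,
  -- counted mod 2.
  let s : ℤ × ℤ → ZMod 2 := fun p => ∑ i ∈ Finset.Ioc M p.1, C ((i, p.2), true)
  have hs0 : ∀ x y, x ≤ M → s (x, y) = 0 := by
    intro x y hx
    simp [s, Finset.Ioc_eq_empty (not_lt.mpr hx)]
  have hs1 : ∀ x y, M < x → s (x, y) = s (x - 1, y) + C ((x, y), true) := by
    intro x y hx
    have : Finset.Ioc M x = insert x (Finset.Ioc M (x - 1)) := by
      ext i
      simp only [Finset.mem_Ioc, Finset.mem_insert]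
      omega
    simp only [s]
    rw [this, Finset.sum_insert (by simp), add_comm]
  refine ⟨s, ?_⟩
  have two : (2 : ZMod 2) = 0 := CharTwo.two_eq_zero
  rintro ⟨⟨x, y⟩, b⟩
  cases b
  · simp only [side]
    rcases le_or_gt x M with hx | hx
    · rw [hs0 _ _ hx, hs0 _ _ hx, hM _ hx, add_zero]
    · revert hx
      -- For horizontal edges, the vanishing boundary at each grid point carries the identity one
      -- column to the right.
      have : ∀ n : ℕ, C ((M + n, y), false) = s (M + n, y) + s (M + n, y - 1) := by
        intro n
        induction n with
        | zero => simp [hs0, hM]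
        | succ n ih =>
          have h0 := DFunLike.congr_fun h (M + (n + 1 : ℕ), y)
          rw [boundary_apply, Finsupp.zero_apply] at h0
          have e1 := hs1 (M + (n + 1 : ℕ)) y (by omega)
          have e2 := hs1 (M + (n + 1 : ℕ)) (y - 1) (by omega)
          have e : M + (n + 1 : ℕ) - 1 = M + n := by omega
          rw [e] at h0 e1 e2
          rw [ih] at h0
          rw [e1, e2]
          linear_combination h0 - (s (M + n, y) + s (M + n, y - 1)
            + C ((M + (n + 1 : ℕ), y), true) + C ((M + (n + 1 : ℕ), y - 1), true)) * two
      intro hx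
      have := this (x - M).toNat
      rwa [show M + ((x - M).toNat : ℤ) = x by omega] at this
  · simp only [side]
    rcases le_or_gt x M with hx | hx
    · rw [hs0 _ _ hx, hs0 _ _ (by omega), hM _ hx, add_zero]
    · rw [hs1 _ _ hx]
      linear_combination - s (x - 1, y) * two

/-! ### Grid paths and minor models. -/

/-- Two points are joined by a grid edge. -/
def Adj (p q : ℤ × ℤ) : Prop := ∃ e, (e.1 = p ∧ head e = q) ∨ (e.1 = q ∧ head e = p)

theorem Adj.symm {p q : ℤ × ℤ} (h : Adj p q) : Adj q p := by
  obtain ⟨e, he⟩ := h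
  exact ⟨e, he.symm⟩

/-- Two points are joined by a grid path inside `S`. -/
def Conn (S : Set (ℤ × ℤ)) : ℤ × ℤ → ℤ × ℤ → Prop :=
  Relation.ReflTransGen fun p q => p ∈ S ∧ q ∈ S ∧ Adj p q

theorem Conn.symm {S : Set (ℤ × ℤ)} {p q : ℤ × ℤ} (h : Conn S p q) : Conn S q p :=
  (@Relation.ReflTransGen.stdSymm _ _ ⟨fun _ _ h => ⟨h.2.1, h.1, h.2.2.symm⟩⟩).symm _ _ h

theorem Conn.trans {S : Set (ℤ × ℤ)} {p q r : ℤ × ℤ} (h : Conn S p q) (h' : Conn S q r) :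
    Conn S p r :=
  Relation.ReflTransGen.trans h h'

theorem Conn.mono {S T : Set (ℤ × ℤ)} (hST : S ⊆ T) {p q : ℤ × ℤ} (h : Conn S p q) : Conn T p q :=
  Relation.ReflTransGen.mono (fun _ _ h => ⟨hST h.1, hST h.2.1, h.2.2⟩) _ _ h

/-- Add the edges of the path mod 2; its inner points cancel in the boundary. -/
theorem Conn.exists_chain {S : Set (ℤ × ℤ)} {p q : ℤ × ℤ} (h : Conn S p q) :
    ∃ C, boundary C = Finsupp.single p 1 + Finsupp.single q 1 ∧
      ∀ e, C e ≠ 0 → e.1 ∈ S ∧ head e ∈ S := by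
  have two : ∀ p : ℤ × ℤ, Finsupp.single p (1 : ZMod 2) + Finsupp.single p 1 = 0 := by
    intro p
    rw [← Finsupp.single_add, CharTwo.add_self_eq_zero, Finsupp.single_zero]
  induction h with
  | refl => exact ⟨0, by rw [map_zero, two], by simp⟩
  | @tail q r _ hqr ih =>
    obtain ⟨C, hC, hS⟩ := ih
    obtain ⟨hq, hr, e, he⟩ := hqr
    refine ⟨C + Finsupp.single e 1, ?_, ?_⟩
    · rw [map_add, hC, boundary_single, one_smul]
      rcases he with ⟨h1, h2⟩ | ⟨h1, h2⟩
      · rw [h1, h2, add_assoc, ← add_assoc (Finsupp.single q 1), two, zero_add]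
      · rw [h1, h2, add_comm (Finsupp.single r 1), add_assoc, ← add_assoc (Finsupp.single q 1), two,
          zero_add]
    · intro e' he'
      by_cases h : e' = e
      · subst h
        rcases he with ⟨h1, h2⟩ | ⟨h1, h2⟩
        · rw [h1, h2]; exact ⟨hq, hr⟩
        · rw [h1, h2]; exact ⟨hr, hq⟩
      · rw [Finsupp.add_apply, Finsupp.single_eq_of_ne h, add_zero] at he'
        exact hS e' he'

/-- The sets `B v` form a model of `H` as a minor of the grid. -/
structure IsModel {V : Type*} (H : SimpleGraph V) (B : V → Set (ℤ × ℤ)) : Prop where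
  finite : ∀ v, (B v).Finite
  disjoint : ∀ u v p, p ∈ B u → p ∈ B v → u = v
  conn : ∀ v p q, p ∈ B v → q ∈ B v → Conn (B v) p q
  adj : ∀ u v, H.Adj u v → ∃ p ∈ B u, ∃ q ∈ B v, Adj p q

theorem IsModel.mono {V : Type*} {G H : SimpleGraph V} {B : V → Set (ℤ × ℤ)} (h : IsModel G B)
    (hHG : H ≤ G) : IsModel H B :=
  ⟨h.finite, h.disjoint, h.conn, fun u v huv => h.adj u v (hHG huv)⟩

end Grid

/-! ### A dimension bound by double counting. -/

/-- A linear code over `ZMod 2` that is spanned by words of weight at least `n` covering every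
coordinate at most twice has small dimension. -/
theorem mul_finrank_span_le {E F : Type*} [Fintype E] (d : F → E → ZMod 2) (a b : E → F)
    (hab : ∀ x e, d x e ≠ 0 → x = a e ∨ x = b e) (n : ℕ)
    (hn : ∀ x, d x ≠ 0 → n ≤ (Finset.univ.filter fun e => d x e ≠ 0).card) :
    n * Module.finrank (ZMod 2) (Submodule.span (ZMod 2) (Set.range d)) ≤ 2 * Fintype.card E := by
  classical
  -- Choose a basis among the spanning words and count pairs of a basis word and a coordinate where
  -- it is nonzero.
  obtain ⟨t, hts, hspan, hli⟩ := exists_linearIndependent (ZMod 2) (Set.range d)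
  have hfin : t.Finite := Set.toFinite t
  have : Fintype t := hfin.fintype
  rw [← hspan, finrank_span_set_eq_card hli]
  have hcount := Finset.sum_card_bipartiteAbove_eq_sum_card_bipartiteBelow
    (s := t.toFinset) (t := Finset.univ) (fun (x : E → ZMod 2) e => x e ≠ 0)
  have h1 : n * t.toFinset.card ≤
      ∑ x ∈ t.toFinset, (Finset.bipartiteAbove (fun (x : E → ZMod 2) e => x e ≠ 0) Finset.univ x).card := by
    rw [mul_comm, ← smul_eq_mul]
    refine Finset.card_nsmul_le_sum _ _ _ fun x hx => ?_
    have hxt : x ∈ t := Set.mem_toFinset.mp hx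
    obtain ⟨y, rfl⟩ := hts hxt
    exact hn y (hli.ne_zero ⟨_, hxt⟩)
  have h2 : ∑ e, (Finset.bipartiteBelow (fun (x : E → ZMod 2) e => x e ≠ 0) t.toFinset e).card
      ≤ Fintype.card E * 2 := by
    rw [← smul_eq_mul, ← Finset.card_univ]
    refine Finset.sum_le_card_nsmul _ _ _ fun e _ => ?_
    refine (Finset.card_le_card (t := {d (a e), d (b e)}) fun x hx => ?_).trans Finset.card_le_two
    rw [Finset.mem_bipartiteBelow, Set.mem_toFinset] at hx
    obtain ⟨y, rfl⟩ := hts hx.1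
    rcases hab y e hx.2 with h | h <;> simp [h]
  omega

/-! ### Faces of a model, and the cycle space of the graph. -/

namespace Grid

variable {V E : Type*}

/-- The incidence map over `ZMod 2` of the graph whose edge `e` joins `t e` and `h e`. -/
noncomputable def incidence [DecidableEq V] [Fintype E] (t h : E → V) :
    (E → ZMod 2) →ₗ[ZMod 2] (V → ZMod 2) :=
  Fintype.linearCombination (ZMod 2) fun e => Pi.single (t e) 1 + Pi.single (h e) 1

theorem incidence_apply [DecidableEq V] [Fintype E] (t h : E → V) (z : E → ZMod 2) (v : V) :
    incidence t h z v =
      ∑ e, z e * ((if t e = v then 1 else 0) + (if h e = v then 1 else 0)) := by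
  simp [incidence, Fintype.linearCombination_apply, Finset.sum_apply, Pi.single_apply, eq_comm, mul_add]

/-- The grid edges inside the sets `B v`, together with the chosen edges `g e`. -/
def used (B : V → Set (ℤ × ℤ)) (g : E → (ℤ × ℤ) × Bool) : Set ((ℤ × ℤ) × Bool) :=
  {k | (∃ v, k.1 ∈ B v ∧ head k ∈ B v) ∨ k ∈ Set.range g}

/-- The faces: squares are identified when they share a grid edge that is not used. -/
def Face (B : V → Set (ℤ × ℤ)) (g : E → (ℤ × ℤ) × Bool) : Type :=
  Quot fun p q => ∃ k, k ∉ used B g ∧ p = k.1 ∧ q = side k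

/-- The face of a square. -/
def face (B : V → Set (ℤ × ℤ)) (g : E → (ℤ × ℤ) × Bool) (p : ℤ × ℤ) : Face B g := Quot.mk _ p

open Classical in
/-- The chosen edges that have the face `x` on exactly one side. -/
noncomputable def faceBoundary (B : V → Set (ℤ × ℤ)) (g : E → (ℤ × ℤ) × Bool) (x : Face B g) (e : E) :
    ZMod 2 :=
  (if x = face B g (g e).1 then 1 else 0) + (if x = face B g (side (g e)) then 1 else 0)

theorem used_finite [Finite V] [Finite E] {B : V → Set (ℤ × ℤ)} (hB : ∀ v, (B v).Finite)
    (g : E → (ℤ × ℤ) × Bool) : (used B g).Finite := by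
  refine (((Set.finite_iUnion hB).prod (Set.finite_univ (α := Bool))).union
    (Set.finite_range g)).subset ?_
  rintro ⟨p, b⟩ (⟨v, hv, -⟩ | h)
  · exact Or.inl ⟨Set.mem_iUnion.mpr ⟨v, hv⟩, trivial⟩
  · exact Or.inr h

/-- Contracting the sets `B v` turns cycles supported on the used edges into cycles. -/
theorem incidence_eq_zero [DecidableEq V] [Fintype E] {H : SimpleGraph V} {B : V → Set (ℤ × ℤ)}
    (hB : IsModel H B) {t h : E → V} {g : E → (ℤ × ℤ) × Bool} (hg : Function.Injective g)
    (ht : ∀ e, (g e).1 ∈ B (t e)) (hh : ∀ e, head (g e) ∈ B (h e))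
    (C : (ℤ × ℤ) × Bool →₀ ZMod 2) (hC : boundary C = 0) (hCu : ∀ k, C k ≠ 0 → k ∈ used B g) :
    incidence t h (fun e => C (g e)) = 0 := by
  classical
  ext v
  rw [incidence_apply, Pi.zero_apply]
  -- `π` counts the points in `B v` mod 2. A grid edge inside a branch set contributes 0, so only
  -- the chosen edges survive.
  let π : (ℤ × ℤ →₀ ZMod 2) →ₗ[ZMod 2] ZMod 2 :=
    Finsupp.linearCombination (ZMod 2) fun p => if p ∈ B v then 1 else 0
  have hπ : ∀ p, π (Finsupp.single p 1) = if p ∈ B v then 1 else 0 := by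
    intro p
    simp [π, Finsupp.linearCombination_single]
  let F : (ℤ × ℤ) × Bool → ZMod 2 := fun k =>
    C k * ((if k.1 ∈ B v then 1 else 0) + (if head k ∈ B v then 1 else 0))
  have h1 : π (boundary C) = ∑ k ∈ C.support, F k := by
    rw [show boundary C = _ from Finsupp.linearCombination_apply _ _, Finsupp.sum, map_sum]
    refine Finset.sum_congr rfl fun k _ => ?_
    rw [map_smul, map_add, hπ, hπ, smul_eq_mul]
  have h2 : ∑ᶠ k, F k = ∑ k ∈ C.support, F k := by
    refine finsum_eq_sum_of_support_subset _ fun k hk => ?_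
    rw [Finset.mem_coe, Finsupp.mem_support_iff]
    exact left_ne_zero_of_mul hk
  have h3 : ∑ᶠ k, F k = ∑ k ∈ Finset.univ.image g, F k := by
    refine finsum_eq_sum_of_support_subset _ fun k hk => ?_
    rcases hCu k (left_ne_zero_of_mul hk) with ⟨u, hu, hu'⟩ | h
    · exfalso
      apply right_ne_zero_of_mul hk
      by_cases huv : u = v
      · subst huv
        rw [if_pos hu, if_pos hu']
        exact CharTwo.add_self_eq_zero _
      · rw [if_neg fun h => huv (hB.disjoint _ _ _ hu h),
          if_neg fun h => huv (hB.disjoint _ _ _ hu' h), add_zero]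
    · simpa using h
  rw [Finset.sum_image hg.injOn, h2, ← h1, hC, map_zero] at h3
  refine Eq.trans ?_ h3.symm
  refine Finset.sum_congr rfl fun e _ => ?_
  have e1 : (g e).1 ∈ B v ↔ t e = v := ⟨fun h => hB.disjoint _ _ _ (ht e) h, fun h => h ▸ ht e⟩
  have e2 : head (g e) ∈ B v ↔ h e = v := ⟨fun h => hB.disjoint _ _ _ (hh e) h, fun h => h ▸ hh e⟩
  simp only [F, e1, e2]

/-- The indicator of a face agrees on both sides of every unused grid edge, so its coboundary is a
grid cycle supported on used edges, and contraction applies. -/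
theorem incidence_faceBoundary [DecidableEq V] [Finite V] [Fintype E] {H : SimpleGraph V}
    {B : V → Set (ℤ × ℤ)}
    (hB : IsModel H B) {t h : E → V} {g : E → (ℤ × ℤ) × Bool} (hg : Function.Injective g)
    (ht : ∀ e, (g e).1 ∈ B (t e)) (hh : ∀ e, head (g e) ∈ B (h e)) (x : Face B g) :
    incidence t h (faceBoundary B g x) = 0 := by
  classical
  let s : ℤ × ℤ → ZMod 2 := fun p => if x = face B g p then 1 else 0
  have hs : ∀ k, k ∉ used B g → s k.1 + s (side k) = 0 := by
    intro k hk
    have : face B g k.1 = face B g (side k) := Quot.sound ⟨k, hk, rfl, rfl⟩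
    simp only [s, this]
    exact CharTwo.add_self_eq_zero _
  let C := Finsupp.ofSupportFinite (fun k => s k.1 + s (side k))
    ((used_finite hB.finite g).subset fun k hk => by_contra fun h => hk (hs k h))
  exact incidence_eq_zero hB hg ht hh C (boundary_eq_zero_of_eq_add C s fun _ => rfl)
    fun k hk => by_contra fun h => hk (hs k h)

/-- The face boundaries span the cycle space. -/
theorem ker_incidence_le_span [DecidableEq V] [Fintype V] [Fintype E] {H : SimpleGraph V}
    {B : V → Set (ℤ × ℤ)}
    (hB : IsModel H B) {t h : E → V} {g : E → (ℤ × ℤ) × Bool} (hg : Function.Injective g)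
    (ht : ∀ e, (g e).1 ∈ B (t e)) (hh : ∀ e, head (g e) ∈ B (h e)) (hne : ∀ e, t e ≠ h e) :
    LinearMap.ker (incidence t h) ≤ Submodule.span (ZMod 2) (Set.range (faceBoundary B g)) := by
  classical
  intro z hz
  rw [LinearMap.mem_ker] at hz
  -- A root in each branch set; 0 is a default for an empty set.
  let r : V → ℤ × ℤ := fun v => if hv : (B v).Nonempty then hv.some else 0
  have hr : ∀ v p, p ∈ B v → r v ∈ B v := by
    intro v p hp
    have hv : (B v).Nonempty := ⟨p, hp⟩
    simp only [r, dif_pos hv]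
    exact hv.some_mem
  choose c₁ hc₁ hc₁B using fun e => (hB.conn _ _ _ (ht e) (hr _ _ (ht e))).exists_chain
  choose c₂ hc₂ hc₂B using fun e => (hB.conn _ _ _ (hh e) (hr _ _ (hh e))).exists_chain
  -- Lift `z` to the grid: each chosen edge is extended inside its two branch sets to their roots.
  let C : (ℤ × ℤ) × Bool →₀ ZMod 2 := ∑ e, z e • (Finsupp.single (g e) 1 + c₁ e + c₂ e)
  have hCapply : ∀ k, C k = ∑ e, z e * (Finsupp.single (g e) 1 k + c₁ e k + c₂ e k) := by
    intro k
    simp only [C, Finsupp.finsetSum_apply, Finsupp.smul_apply, Finsupp.add_apply, smul_eq_mul]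
  -- A chosen edge joins different branch sets, so no connecting chain inside one of them contains
  -- it.
  have hin : ∀ e v, (g e).1 ∈ B v → head (g e) ∈ B v → False := fun e v h1 h2 =>
    hne e ((hB.disjoint _ _ _ (ht e) h1).trans (hB.disjoint _ _ _ (hh e) h2).symm)
  have hCg : ∀ e, C (g e) = z e := by
    intro e
    rw [hCapply, Finset.sum_eq_single e]
    · have h1 : c₁ e (g e) = 0 := by_contra fun h => hin _ _ (hc₁B e _ h).1 (hc₁B e _ h).2
      have h2 : c₂ e (g e) = 0 := by_contra fun h => hin _ _ (hc₂B e _ h).1 (hc₂B e _ h).2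
      rw [h1, h2, Finsupp.single_eq_same]
      ring
    · intro e' _ he'
      have h1 : c₁ e' (g e) = 0 := by_contra fun h => hin _ _ (hc₁B e' _ h).1 (hc₁B e' _ h).2
      have h2 : c₂ e' (g e) = 0 := by_contra fun h => hin _ _ (hc₂B e' _ h).1 (hc₂B e' _ h).2
      rw [h1, h2, Finsupp.single_eq_of_ne fun h => he' (hg h).symm]
      ring
    · simp
  have hCu : ∀ k, k ∉ used B g → C k = 0 := by
    intro k hk
    rw [hCapply]
    refine Finset.sum_eq_zero fun e _ => ?_
    have h0 : k ≠ g e := fun h => hk (Or.inr ⟨e, h.symm⟩)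
    have h1 : c₁ e k = 0 := by_contra fun h => hk (Or.inl ⟨_, hc₁B e _ h⟩)
    have h2 : c₂ e k = 0 := by_contra fun h => hk (Or.inl ⟨_, hc₂B e _ h⟩)
    rw [h1, h2, Finsupp.single_eq_of_ne h0]
    ring
  have hCb : boundary C = 0 := by
    -- A lifted edge has the two roots as boundary, so the boundary of the lift is the incidence
    -- vector of `z` transported to the roots.
    let ρ : (V → ZMod 2) →ₗ[ZMod 2] (ℤ × ℤ →₀ ZMod 2) :=
      Fintype.linearCombination (ZMod 2) fun v => Finsupp.single (r v) 1
    have : boundary C = ρ (incidence t h z) := by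
      simp only [C, incidence, Fintype.linearCombination_apply, map_sum, map_smul, map_add]
      refine Finset.sum_congr rfl fun e _ => ?_
      congr 1
      rw [hc₁, hc₂, boundary_single, one_smul]
      simp only [ρ, Fintype.linearCombination_apply_single, one_smul]
      have two : ∀ p : ℤ × ℤ, Finsupp.single p (1 : ZMod 2) + Finsupp.single p 1 = 0 := by
        intro p
        rw [← Finsupp.single_add, CharTwo.add_self_eq_zero, Finsupp.single_zero]
      calc _ = (Finsupp.single (g e).1 1 + Finsupp.single (g e).1 1)
            + (Finsupp.single (head (g e)) 1 + Finsupp.single (head (g e)) 1)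
            + (Finsupp.single (r (t e)) 1 + Finsupp.single (r (h e)) (1 : ZMod 2)) := by abel
        _ = _ := by rw [two, two, zero_add, zero_add]
    rw [this, hz, map_zero]
  obtain ⟨s, hs⟩ := exists_eq_add_of_boundary_eq_zero C hCb
  -- `C` vanishes on unused edges, so `s` is constant on faces.
  let s' : Face B g → ZMod 2 := Quot.lift s (by
    rintro p q ⟨k, hk, rfl, rfl⟩
    have := hs k
    rw [hCu k hk] at this
    exact (CharTwo.add_eq_zero.mp this.symm))
  -- Only the finitely many faces beside chosen edges affect the coordinates of `z`.
  let T : Finset (Face B g) :=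
    Finset.univ.image (fun e => face B g (g e).1) ∪ Finset.univ.image fun e => face B g (side (g e))
  have hz' : z = ∑ x ∈ T, s' x • faceBoundary B g x := by
    ext e
    have m1 : face B g (g e).1 ∈ T :=
      Finset.mem_union_left _ (Finset.mem_image_of_mem _ (Finset.mem_univ e))
    have m2 : face B g (side (g e)) ∈ T := Finset.mem_union_right _
      (Finset.mem_image_of_mem (fun e => face B g (side (g e))) (Finset.mem_univ e))
    rw [Finset.sum_apply]
    simp only [Pi.smul_apply, faceBoundary, smul_eq_mul, mul_add, mul_ite, mul_one, mul_zero,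
      Finset.sum_add_distrib, Finset.sum_ite_eq', m1, m2, if_true]
    rw [← hCg e, hs]
    rfl
  rw [hz']
  exact Submodule.sum_mem _ fun x _ => Submodule.smul_mem _ _ (Submodule.subset_span ⟨x, rfl⟩)

/-- Rank-nullity: fixing a vertex o of `U`, the range is spanned by the vectors u + o with u in `U`
and u ≠ o, so the rank is at most |U| - 1. -/
theorem card_le_finrank_ker_incidence [DecidableEq V] [Fintype V] [Fintype E] (t h : E → V)
    (U : Finset V) (hU : U.Nonempty) (ht : ∀ e, t e ∈ U) (hh : ∀ e, h e ∈ U) :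
    Fintype.card E + 1 ≤ Module.finrank (ZMod 2) (LinearMap.ker (incidence t h)) + U.card := by
  classical
  obtain ⟨o, ho⟩ := hU
  have hsum := LinearMap.finrank_range_add_finrank_ker (incidence t h)
  rw [Module.finrank_fintype_fun_eq_card] at hsum
  have two : ∀ f : V → ZMod 2, f + f = 0 := fun f => funext fun _ => CharTwo.add_self_eq_zero _
  let T : Finset (V → ZMod 2) := (U.erase o).image fun u => Pi.single u 1 + Pi.single o 1
  have hmem : ∀ u ∈ U, (Pi.single u 1 + Pi.single o 1 : V → ZMod 2) ∈
      Submodule.span (ZMod 2) (T : Set (V → ZMod 2)) := by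
    intro u hu
    by_cases huo : u = o
    · subst huo
      rw [two]
      exact Submodule.zero_mem _
    · exact Submodule.subset_span (Finset.mem_coe.mpr
        (Finset.mem_image_of_mem _ (Finset.mem_erase.mpr ⟨huo, hu⟩)))
  have hle : LinearMap.range (incidence t h) ≤ Submodule.span (ZMod 2) (T : Set (V → ZMod 2)) := by
    rintro _ ⟨z, rfl⟩
    rw [incidence, Fintype.linearCombination_apply]
    refine Submodule.sum_mem _ fun e _ => Submodule.smul_mem _ _ ?_
    have : (Pi.single (t e) 1 + Pi.single (h e) 1 : V → ZMod 2) =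
        (Pi.single (t e) 1 + Pi.single o 1) + (Pi.single (h e) 1 + Pi.single o 1) := by
      rw [add_add_add_comm, two, add_zero]
    rw [this]
    exact Submodule.add_mem _ (hmem _ (ht e)) (hmem _ (hh e))
  have h1 := (Submodule.finrank_mono hle).trans (finrank_span_finset_le_card T)
  have h2 : T.card ≤ U.card - 1 := Finset.card_image_le.trans (Finset.card_erase_of_mem ho).le
  have h3 : 0 < U.card := Finset.card_pos.mpr ⟨o, ho⟩
  omega

/-- In a triangle-free graph every nonzero element of the cycle space has at least four edges. -/
theorem four_le_card_of_incidence_eq_zero [DecidableEq V] {H : SimpleGraph V} [Fintype H.edgeSet]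
    (htri : ∀ a b c, H.Adj a b → H.Adj b c → H.Adj a c → False) (t h : H.edgeSet → V)
    (hth : ∀ e : H.edgeSet, (e : Sym2 V) = s(t e, h e)) (z : H.edgeSet → ZMod 2) (hz : incidence t h z = 0)
    (hz0 : z ≠ 0) : 4 ≤ (Finset.univ.filter fun e => z e ≠ 0).card := by
  classical
  let Z : Finset (Sym2 V) := (Finset.univ.filter fun e => z e ≠ 0).image Subtype.val
  have hZc : Z.card = (Finset.univ.filter fun e => z e ≠ 0).card :=
    Finset.card_image_of_injective _ Subtype.val_injective
  have hZadj : ∀ u v, s(u, v) ∈ Z → H.Adj u v := by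
    intro u v huv
    obtain ⟨e, -, he⟩ := Finset.mem_image.mp huv
    have := e.2
    rwa [he] at this
  -- A vertex on only one edge of the support would have nonzero incidence.
  have hstep : ∀ u v, s(u, v) ∈ Z → ∃ w, w ≠ v ∧ s(u, w) ∈ Z := by
    intro u v huv
    by_contra! hcon
    obtain ⟨e, he, heq⟩ := Finset.mem_image.mp huv
    have hadj := hZadj u v huv
    have h0 := congrFun hz u
    rw [incidence_apply, Finset.sum_eq_single e] at h0
    · rw [Finset.mem_filter] at he
      have h1 := (hth e).symm.trans heq
      rw [Sym2.eq_iff] at h1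
      rcases h1 with ⟨h1, h2⟩ | ⟨h1, h2⟩
      · rw [h1, h2, if_pos rfl, if_neg hadj.ne', add_zero, mul_one] at h0
        exact he.2 h0
      · rw [h1, h2, if_pos rfl, if_neg hadj.ne', zero_add, mul_one] at h0
        exact he.2 h0
    · intro e' _ hne
      by_cases hze : z e' = 0
      · rw [hze, zero_mul]
      have hmem : s(t e', h e') ∈ Z := Finset.mem_image.mpr ⟨e', by simp [hze], hth e'⟩
      have ht : t e' ≠ u := by
        intro ht
        by_cases hv : h e' = v
        · exact hne (Subtype.ext (by rw [hth e', heq, ht, hv]))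
        · exact hcon _ hv (ht ▸ hmem)
      have hh : h e' ≠ u := by
        intro hh
        by_cases hv : t e' = v
        · exact hne (Subtype.ext (by rw [hth e', heq, hh, hv, Sym2.eq_swap]))
        · exact hcon _ hv (by rw [Sym2.eq_swap, ← hh]; exact hmem)
      rw [if_neg ht, if_neg hh, add_zero, mul_zero]
    · simp
  rw [← hZc]
  obtain ⟨e, he⟩ : ∃ e, z e ≠ 0 := by
    by_contra! hcon
    exact hz0 (funext hcon)
  have hab : s(t e, h e) ∈ Z := Finset.mem_image.mpr ⟨e, by simp [he], hth e⟩
  generalize t e = a at hab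
  generalize h e = b at hab
  -- Extend ab to a walk d, b, a, c, x without backtracking. The absence of triangles gives c ≠ d,
  -- which makes its four edges distinct.
  obtain ⟨c, hcb, hac⟩ := hstep a b hab
  obtain ⟨d, hda, hbd⟩ := hstep b a (by rwa [Sym2.eq_swap])
  obtain ⟨x, hxa, hcx⟩ := hstep c a (by rwa [Sym2.eq_swap])
  have nab := (hZadj _ _ hab).ne
  have nac := (hZadj _ _ hac).ne
  have nbd := (hZadj _ _ hbd).ne
  have ncx := (hZadj _ _ hcx).ne
  have ncd : c ≠ d := by
    rintro rfl
    exact htri _ _ _ (hZadj _ _ hab) (hZadj _ _ hbd) (hZadj _ _ hac)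
  have hsub : ({s(a, b), s(a, c), s(b, d), s(c, x)} : Finset (Sym2 V)) ⊆ Z := by
    intro y hy
    simp only [Finset.mem_insert, Finset.mem_singleton] at hy
    rcases hy with rfl | rfl | rfl | rfl <;> assumption
  refine le_trans (le_of_eq ?_) (Finset.card_le_card hsub)
  rw [Finset.card_insert_of_notMem, Finset.card_insert_of_notMem, Finset.card_insert_of_notMem,
    Finset.card_singleton]
  all_goals
    simp only [Finset.mem_insert, Finset.mem_singleton, Sym2.eq_iff]
    grind

/-- A triangle-free graph with a model in the grid is sparse. -/
theorem IsModel.ncard_edgeSet_lt [Finite V] {H : SimpleGraph V} {B : V → Set (ℤ × ℤ)}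
    (hB : IsModel H B) (htri : ∀ a b c, H.Adj a b → H.Adj b c → H.Adj a c → False) (hne : H ≠ ⊥) :
    H.edgeSet.ncard < 2 * {v | ∃ w, H.Adj v w}.ncard := by
  classical
  have : Fintype V := Fintype.ofFinite V
  have hex : ∀ e : H.edgeSet, ∃ (g : (ℤ × ℤ) × Bool) (t h : V), (e : Sym2 V) = s(t, h) ∧
      g.1 ∈ B t ∧ head g ∈ B h := by
    rintro ⟨e, he⟩
    induction e with | _ u v
    obtain ⟨p, hp, q, hq, k, hk | hk⟩ := hB.adj u v he
    · exact ⟨k, u, v, rfl, hk.1 ▸ hp, hk.2 ▸ hq⟩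
    · exact ⟨k, v, u, Sym2.eq_swap, hk.1 ▸ hq, hk.2 ▸ hp⟩
  choose g t h hth ht hh using hex
  have hadj : ∀ e, H.Adj (t e) (h e) := by
    intro e
    rw [← SimpleGraph.mem_edgeSet, ← hth]
    exact e.2
  have hg : Function.Injective g := by
    intro e e' hee
    have h1 := hB.disjoint _ _ _ (ht e) (hee ▸ ht e')
    have h2 := hB.disjoint _ _ _ (hh e) (hee ▸ hh e')
    exact Subtype.ext (by rw [hth, hth, h1, h2])
  have h1 := mul_finrank_span_le (faceBoundary B g) (fun e => face B g (g e).1)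
    (fun e => face B g (side (g e))) (by
      intro x e hx
      by_contra! hc
      apply hx
      simp [faceBoundary, hc.1, hc.2]) 4
    (fun x hx => four_le_card_of_incidence_eq_zero htri t h hth _
      (incidence_faceBoundary hB hg ht hh x) hx)
  have h2 := Submodule.finrank_mono (ker_incidence_le_span hB hg ht hh fun e => (hadj e).ne)
  let U : Finset V := Finset.univ.filter fun v => ∃ w, H.Adj v w
  have hUc : {v | ∃ w, H.Adj v w}.ncard = U.card := by
    rw [← Set.ncard_coe_finset]
    simp [U]
  obtain ⟨a, b, hab⟩ := SimpleGraph.ne_bot_iff_exists_adj.mp hne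
  have h3 := card_le_finrank_ker_incidence t h U ⟨a, by simpa [U] using ⟨b, hab⟩⟩
    (fun e => by simpa [U] using ⟨_, hadj e⟩) (fun e => by simpa [U] using ⟨_, (hadj e).symm⟩)
  have h4 : H.edgeSet.ncard = Fintype.card H.edgeSet := by
    rw [← Nat.card_coe_set_eq, Nat.card_eq_fintype_card]
  have h5 : 0 < U.card := Finset.card_pos.mpr ⟨a, by simpa [U] using ⟨b, hab⟩⟩
  -- Now 4(|E| + 1 - |U|) ≤ 2|E|, that is |E| ≤ 2|U| - 2.
  rw [hUc, h4]
  omega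

end Grid

/-! ### From drawings to models in the grid -/

namespace Grid

/-- The grid points at distance less than two from `X` in the maximum norm. -/
def near (X : Set (ℝ × ℝ)) : Set (ℤ × ℤ) :=
  {p | ∃ x ∈ X, |(p.1 : ℝ) - x.1| < 2 ∧ |(p.2 : ℝ) - x.2| < 2}

/-- Rounding down to a grid point. -/
noncomputable def round (x : ℝ × ℝ) : ℤ × ℤ := (⌊x.1⌋, ⌊x.2⌋)

/-- The radius 2 in `near` leaves room for a rounding error below 1 and a displacement below 1. -/
theorem round_near_of_dist_lt {x y : ℝ × ℝ} (h : dist y x < 1) :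
    |((round y).1 : ℝ) - x.1| < 2 ∧ |((round y).2 : ℝ) - x.2| < 2 := by
  rw [Prod.dist_eq, max_lt_iff, Real.dist_eq, Real.dist_eq, abs_lt, abs_lt] at h
  have h1 := Int.floor_le y.1
  have h2 := Int.lt_floor_add_one y.1
  have h3 := Int.floor_le y.2
  have h4 := Int.lt_floor_add_one y.2
  simp only [round, abs_lt]
  refine ⟨⟨?_, ?_⟩, ?_, ?_⟩ <;> linarith [h.1.1, h.1.2, h.2.1, h.2.2]

theorem round_mem_near {X : Set (ℝ × ℝ)} {x : ℝ × ℝ} (hx : x ∈ X) : round x ∈ near X :=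
  ⟨x, hx, round_near_of_dist_lt (by simp)⟩

theorem Conn.horizontal {S : Set (ℤ × ℤ)} {a b j : ℤ} (hab : a ≤ b)
    (h : ∀ i, a ≤ i → i ≤ b → (i, j) ∈ S) : Conn S (a, j) (b, j) := by
  induction b, hab using Int.leInduction with
  | base => exact Relation.ReflTransGen.refl
  | succ n hn ih =>
    exact (ih fun i h1 h2 => h i h1 (by omega)).tail
      ⟨h n hn (by omega), h (n + 1) (by omega) le_rfl, ((n, j), false), Or.inl ⟨rfl, rfl⟩⟩

theorem Conn.vertical {S : Set (ℤ × ℤ)} {a b i : ℤ} (hab : a ≤ b)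
    (h : ∀ j, a ≤ j → j ≤ b → (i, j) ∈ S) : Conn S (i, a) (i, b) := by
  induction b, hab using Int.leInduction with
  | base => exact Relation.ReflTransGen.refl
  | succ n hn ih =>
    exact (ih fun i h1 h2 => h i h1 (by omega)).tail
      ⟨h n hn (by omega), h (n + 1) (by omega) le_rfl, ((i, n), true), Or.inl ⟨rfl, rfl⟩⟩

theorem abs_sub_lt_of_between {a b i : ℤ} {x r : ℝ} (ha : |(a : ℝ) - x| < r) (hb : |(b : ℝ) - x| < r)
    (hai : a ≤ i) (hib : i ≤ b) : |(i : ℝ) - x| < r := by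
  have h1 : (a : ℝ) ≤ i := by exact_mod_cast hai
  have h2 : (i : ℝ) ≤ b := by exact_mod_cast hib
  rw [abs_lt] at *
  constructor <;> linarith

theorem conn_near_of_common {X : Set (ℝ × ℝ)} {x : ℝ × ℝ} (hx : x ∈ X) {p q : ℤ × ℤ}
    (hp : |(p.1 : ℝ) - x.1| < 2 ∧ |(p.2 : ℝ) - x.2| < 2)
    (hq : |(q.1 : ℝ) - x.1| < 2 ∧ |(q.2 : ℝ) - x.2| < 2) : Conn (near X) p q := by
  obtain ⟨p₁, p₂⟩ := p
  obtain ⟨q₁, q₂⟩ := q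
  have h1 : Conn (near X) (p₁, p₂) (q₁, p₂) := by
    rcases le_total p₁ q₁ with h | h
    · exact Conn.horizontal h fun i hi hi' =>
        ⟨x, hx, abs_sub_lt_of_between hp.1 hq.1 hi hi', hp.2⟩
    · exact (Conn.horizontal (S := near X) h fun i hi hi' =>
        ⟨x, hx, abs_sub_lt_of_between hq.1 hp.1 hi hi', hp.2⟩).symm
  have h2 : Conn (near X) (q₁, p₂) (q₁, q₂) := by
    rcases le_total p₂ q₂ with h | h
    · exact Conn.vertical h fun i hi hi' =>
        ⟨x, hx, hq.1, abs_sub_lt_of_between hp.2 hq.2 hi hi'⟩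
    · exact (Conn.vertical (S := near X) h fun i hi hi' =>
        ⟨x, hx, hq.1, abs_sub_lt_of_between hq.2 hp.2 hi hi'⟩).symm
  exact h1.trans h2

/-- Points at distance below 1 round to grid points near a common point of `X`, hence connected;
preconnectedness chains these local steps together. -/
theorem conn_near {X : Set (ℝ × ℝ)} (hX : IsPreconnected X) {p q : ℤ × ℤ} (hp : p ∈ near X)
    (hq : q ∈ near X) : Conn (near X) p q := by
  obtain ⟨x, hx, hp⟩ := hp
  obtain ⟨y, hy, hq⟩ := hq
  have h0 : ∀ x : ℝ × ℝ, |((round x).1 : ℝ) - x.1| < 2 ∧ |((round x).2 : ℝ) - x.2| < 2 :=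
    fun x => round_near_of_dist_lt (by simp)
  have hxy : Conn (near X) (round x) (round y) := by
    refine hX.induction₂ (fun x y => Conn (near X) (round x) (round y)) ?_
      (fun _ _ _ _ _ _ h h' => h.trans h') (fun _ _ _ _ h => h.symm) hx hy
    intro x hx
    filter_upwards [mem_nhdsWithin_of_mem_nhds (Metric.ball_mem_nhds x one_pos)] with y hy
    exact conn_near_of_common hx (h0 x) (round_near_of_dist_lt hy)
  exact ((conn_near_of_common hx hp (h0 x)).trans hxy).trans (conn_near_of_common hy (h0 y) hq)

theorem near_finite {X : Set (ℝ × ℝ)} (hX : IsCompact X) : (near X).Finite := by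
  obtain ⟨R, hR⟩ := hX.isBounded.exists_norm_le
  have key : ∀ (i : ℤ) (x : ℝ), |(i : ℝ) - x| < 2 → |x| ≤ R → i ∈ Set.Icc (-⌈R⌉ - 2) (⌈R⌉ + 2) := by
    intro i x h1 h2
    have h3 := Int.le_ceil R
    rw [abs_lt] at h1
    rw [abs_le] at h2
    constructor
    · have : (-⌈R⌉ - 2 : ℝ) ≤ i := by linarith [h1.1, h2.1]
      exact_mod_cast this
    · have : (i : ℝ) ≤ ⌈R⌉ + 2 := by linarith [h1.2, h2.2]
      exact_mod_cast this
  refine ((Set.finite_Icc (-⌈R⌉ - 2) (⌈R⌉ + 2)).prod (Set.finite_Icc (-⌈R⌉ - 2) (⌈R⌉ + 2))).subset ?_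
  rintro p ⟨x, hx, h1, h2⟩
  have hn := hR x hx
  rw [Prod.norm_def, max_le_iff] at hn
  exact ⟨key _ _ h1 hn.1, key _ _ h2 hn.2⟩

theorem not_mem_near_of_far {X Y : Set (ℝ × ℝ)} (h : ∀ x ∈ X, ∀ y ∈ Y, 4 ≤ dist x y) {p : ℤ × ℤ}
    (hX : p ∈ near X) (hY : p ∈ near Y) : False := by
  obtain ⟨x, hx, hx1, hx2⟩ := hX
  obtain ⟨y, hy, hy1, hy2⟩ := hY
  have := h x hx y hy
  rw [← not_lt, Prod.dist_eq, max_lt_iff, Real.dist_eq, Real.dist_eq] at this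
  apply this
  rw [abs_lt] at *
  rw [abs_lt]
  refine ⟨⟨?_, ?_⟩, ?_, ?_⟩ <;> linarith [hx1.1, hx1.2, hx2.1, hx2.2, hy1.1, hy1.2, hy2.1, hy2.2]

/-- A path from outside `T` to a point of `T` first enters `T` through an edge. -/
theorem Conn.exists_adj_entering {S T : Set (ℤ × ℤ)} {p q : ℤ × ℤ} (h : Conn S p q) (hp : p ∉ T)
    (hq : q ∈ T) : ∃ a b, Conn (S \ T) p a ∧ (a = p ∨ a ∈ S \ T) ∧ b ∈ T ∧ Adj a b := by
  -- Follow the path, recording whether `T` has been entered. The case `a = p` is kept apart because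
  -- the empty path does not require `p ∈ S`.
  suffices H : (Conn (S \ T) p q ∧ q ∉ T) ∨
      ∃ a b, Conn (S \ T) p a ∧ (a = p ∨ a ∈ S \ T) ∧ b ∈ T ∧ Adj a b by
    exact H.resolve_left fun h => h.2 hq
  clear hq
  induction h with
  | refl => exact Or.inl ⟨Relation.ReflTransGen.refl, hp⟩
  | @tail a b _ hab ih =>
    rcases ih with ⟨h1, h2⟩ | h
    · by_cases hb : b ∈ T
      · exact Or.inr ⟨a, b, h1, Or.inr ⟨hab.1, h2⟩, hb, hab.2.2⟩
      · exact Or.inl ⟨h1.tail ⟨⟨hab.1, h2⟩, ⟨hab.2.1, hb⟩, hab.2.2⟩, hb⟩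
    · exact Or.inr h

/-! ### Cutting a drawing into stars and middle thirds. -/

/-- A third of the unit interval. -/
noncomputable def lo : unitInterval := ⟨1 / 3, by norm_num, by norm_num⟩

/-- Two thirds of the unit interval. -/
noncomputable def hi : unitInterval := ⟨2 / 3, by norm_num, by norm_num⟩

theorem lo_pos : 0 < lo := by
  rw [← Subtype.coe_lt_coe]; norm_num [lo]

theorem lo_lt_hi : lo < hi := by
  rw [← Subtype.coe_lt_coe]; norm_num [lo, hi]

theorem hi_lt_one : hi < 1 := by
  rw [← Subtype.coe_lt_coe]; norm_num [hi]

section Drawing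

variable {V E P : Type*} (point : V → P) (arc : E → unitInterval → P) (a b : E → V)

/-- The point of `u` with the outer thirds of the arcs that end there, where the arc of `e` runs from
the point of `a e` to the point of `b e`. -/
def star (u : V) : Set P :=
  {point u} ∪ ⋃ e, ((⋃ _ : a e = u, arc e '' Set.Iic lo) ∪ ⋃ _ : b e = u, arc e '' Set.Ici hi)

/-- The middle third of an arc. -/
def mid (e : E) : Set P := arc e '' Set.Icc lo hi

theorem mem_star {u : V} {x : P} : x ∈ star point arc a b u ↔ x = point u ∨
    ∃ e t, ((a e = u ∧ t ≤ lo) ∨ (b e = u ∧ hi ≤ t)) ∧ arc e t = x := by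
  simp only [star, Set.mem_union, Set.mem_singleton_iff, Set.mem_iUnion, Set.mem_image, Set.mem_Iic,
    Set.mem_Ici, exists_prop]
  refine or_congr_right (exists_congr fun e => ?_)
  constructor
  · rintro (⟨h, t, ht, rfl⟩ | ⟨h, t, ht, rfl⟩)
    · exact ⟨t, Or.inl ⟨h, ht⟩, rfl⟩
    · exact ⟨t, Or.inr ⟨h, ht⟩, rfl⟩
  · rintro ⟨t, ⟨h, ht⟩ | ⟨h, ht⟩, rfl⟩
    · exact Or.inl ⟨h, t, ht, rfl⟩
    · exact Or.inr ⟨h, t, ht, rfl⟩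

variable [TopologicalSpace P]

theorem isCompact_star [Finite E] (hc : ∀ e, Continuous (arc e)) (u : V) :
    IsCompact (star point arc a b u) := by
  refine isCompact_singleton.union (isCompact_iUnion fun e => ?_)
  exact (isCompact_iUnion fun _ => isClosed_Iic.isCompact.image (hc e)).union
    (isCompact_iUnion fun _ => isClosed_Ici.isCompact.image (hc e))

theorem isCompact_mid (hc : ∀ e, Continuous (arc e)) (e : E) : IsCompact (mid arc e) :=
  isCompact_Icc.image (hc e)

theorem isPreconnected_star (hc : ∀ e, Continuous (arc e)) (h0 : ∀ e, arc e 0 = point (a e))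
    (h1 : ∀ e, arc e 1 = point (b e)) (u : V) : IsPreconnected (star point arc a b u) := by
  refine isPreconnected_of_forall (point u) fun y hy => ?_
  rw [mem_star] at hy
  rcases hy with rfl | ⟨e, t, ⟨rfl, ht⟩ | ⟨rfl, ht⟩, rfl⟩
  · exact ⟨{point u}, by simp [star], rfl, rfl, isPreconnected_singleton⟩
  · refine ⟨arc e '' Set.Icc 0 lo, ?_, ⟨0, ⟨le_rfl, lo_pos.le⟩, h0 e⟩, ⟨t, ⟨unitInterval.nonneg', ht⟩, rfl⟩,
      isPreconnected_Icc.image _ (hc e).continuousOn⟩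
    rintro _ ⟨t, ht, rfl⟩
    exact (mem_star _ _ _ _).mpr (Or.inr ⟨e, t, Or.inl ⟨rfl, ht.2⟩, rfl⟩)
  · refine ⟨arc e '' Set.Icc hi 1, ?_, ⟨1, ⟨hi_lt_one.le, le_rfl⟩, h1 e⟩, ⟨t, ⟨ht, unitInterval.le_one'⟩, rfl⟩,
      isPreconnected_Icc.image _ (hc e).continuousOn⟩
    rintro _ ⟨t, ht, rfl⟩
    exact (mem_star _ _ _ _).mpr (Or.inr ⟨e, t, Or.inr ⟨rfl, ht.1⟩, rfl⟩)

end Drawing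

/-- A drawing whose disjoint parts are far apart gives a model in the grid. -/
theorem exists_isModel_of_far {V : Type*} [Finite V] (G : SimpleGraph V) (point : V → ℝ × ℝ)
    (arc : G.edgeSet → unitInterval → ℝ × ℝ) (a b : G.edgeSet → V)
    (hab : ∀ e : G.edgeSet, (e : Sym2 V) = s(a e, b e)) (hc : ∀ e, Continuous (arc e))
    (h0 : ∀ e, arc e 0 = point (a e)) (h1 : ∀ e, arc e 1 = point (b e))
    (hss : ∀ u v, u ≠ v → ∀ x ∈ star point arc a b u, ∀ y ∈ star point arc a b v, 4 ≤ dist x y)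
    (hms : ∀ e v, a e ≠ v → b e ≠ v → ∀ x ∈ mid arc e, ∀ y ∈ star point arc a b v, 4 ≤ dist x y)
    (hmm : ∀ e e', e ≠ e' → ∀ x ∈ mid arc e, ∀ y ∈ mid arc e', 4 ≤ dist x y) :
    ∃ B, IsModel G B := by
  have hne : ∀ e, a e ≠ b e := by
    intro e
    have := e.2
    rw [hab] at this
    exact G.ne_of_adj this
  let S : V → Set (ℤ × ℤ) := fun u => near (star point arc a b u)
  let r : V → ℤ × ℤ := fun u => round (point u)
  have hrS : ∀ u, r u ∈ S u := fun u => round_mem_near ((mem_star _ _ _ _).mpr (Or.inl rfl))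
  have hSS : ∀ u v p, p ∈ S u → p ∈ S v → u = v := fun u v p hu hv =>
    by_contra fun h => not_mem_near_of_far (hss u v h) hu hv
  -- The branch set of u will be its thickened star together with, for each arc starting at u, the
  -- component `C e` followed until the star at the other end. Outside its starting star `C e` lies
  -- near the middle third, which keeps branch sets disjoint.
  let R : G.edgeSet → Set (ℤ × ℤ) := fun e => near (Set.range (arc e)) \ S (b e)
  let C : G.edgeSet → Set (ℤ × ℤ) := fun e => {p | p ∈ R e ∧ Conn (R e) (r (a e)) p}
  have hra : ∀ e, r (a e) ∈ R e := fun e =>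
    ⟨round_mem_near ⟨0, h0 e⟩, fun h => hne e (hSS _ _ _ (hrS _) h)⟩
  have hR : ∀ e p, p ∈ R e → p ∉ S (a e) → p ∈ near (mid arc e) := by
    rintro e p ⟨⟨_, ⟨t, rfl⟩, hp⟩, hpb⟩ hpa
    rcases le_total t lo with ht | ht
    · exact absurd ⟨_, (mem_star _ _ _ _).mpr (Or.inr ⟨e, t, Or.inl ⟨rfl, ht⟩, rfl⟩), hp⟩ hpa
    rcases le_total t hi with ht' | ht'
    · exact ⟨_, ⟨t, ⟨ht, ht'⟩, rfl⟩, hp⟩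
    · exact absurd ⟨_, (mem_star _ _ _ _).mpr (Or.inr ⟨e, t, Or.inr ⟨rfl, ht'⟩, rfl⟩), hp⟩ hpb
  have hCS : ∀ e v p, p ∈ C e → p ∈ S v → a e = v := by
    intro e v p hp hv
    by_contra hav
    have hbv : b e ≠ v := fun h => hp.1.2 (h ▸ hv)
    exact not_mem_near_of_far (hms e v hav hbv)
      (hR e p hp.1 fun h => hav (hSS _ _ _ h hv)) hv
  have hCC : ∀ e e' p, p ∈ C e → p ∈ C e' → a e = a e' := by
    intro e e' p hp hp'
    by_contra hne'
    have hm : p ∈ near (mid arc e) := hR e p hp.1 fun h => hne' (hCS _ _ _ hp' h).symm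
    have hm' : p ∈ near (mid arc e') := hR e' p hp'.1 fun h => hne' (hCS _ _ _ hp h)
    exact not_mem_near_of_far (hmm e e' fun h => hne' (congrArg a h)) hm hm'
  let B : V → Set (ℤ × ℤ) := fun u => S u ∪ ⋃ e, ⋃ _ : a e = u, C e
  have hB : ∀ u p, p ∈ B u ↔ p ∈ S u ∨ ∃ e, a e = u ∧ p ∈ C e := by
    intro u p
    simp [B]
  have hSB : ∀ u, S u ⊆ B u := fun u => Set.subset_union_left
  have hCB : ∀ e, C e ⊆ B (a e) := fun e p hp => (hB _ _).mpr (Or.inr ⟨e, rfl, hp⟩)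
  have hroot : ∀ u p, p ∈ B u → Conn (B u) (r u) p := by
    intro u p hp
    rcases (hB u p).mp hp with h | ⟨e, rfl, h⟩
    · exact (conn_near (isPreconnected_star _ _ _ _ hc h0 h1 u) (hrS u) h).mono (hSB u)
    · refine Conn.mono (hCB e) ?_
      have : ∀ q, Conn (R e) (r (a e)) q → Conn (C e) (r (a e)) q := by
        intro q hq
        induction hq with
        | refl => exact Relation.ReflTransGen.refl
        | @tail x y hx hxy ih =>
          exact ih.tail ⟨⟨hxy.1, hx⟩, ⟨hxy.2.1, hx.tail hxy⟩, hxy.2.2⟩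
      exact this p h.2
  refine ⟨B, ?_, ?_, ?_, ?_⟩
  · intro u
    refine (near_finite (isCompact_star _ _ _ _ hc u)).union (Set.finite_iUnion fun e =>
      Set.finite_iUnion fun _ => ?_)
    exact (near_finite (isCompact_range (hc e))).subset fun p hp => hp.1.1
  · intro u v p hu hv
    rcases (hB u p).mp hu with h | ⟨e, rfl, h⟩ <;> rcases (hB v p).mp hv with h' | ⟨e', rfl, h'⟩
    · exact hSS _ _ _ h h'
    · exact (hCS _ _ _ h' h).symm
    · exact hCS _ _ _ h h'
    · exact hCC _ _ _ h h'
  · intro u p q hp hq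
    exact (hroot u p hp).symm.trans (hroot u q hq)
  · intro u v huv
    have key : ∀ e, ∃ p ∈ B (a e), ∃ q ∈ B (b e), Adj p q := by
      intro e
      -- The thickened arc joins the two roots; where a path first enters the star of `b e`, its
      -- previous point lies in `C e`.
      have hconn : Conn (near (Set.range (arc e))) (r (a e)) (r (b e)) :=
        conn_near (isPreconnected_range (hc e)) (hra e).1 (round_mem_near ⟨1, h1 e⟩)
      obtain ⟨p, q, hp, hp', hq, hpq⟩ := hconn.exists_adj_entering (hra e).2 (hrS (b e))
      refine ⟨p, hCB e ⟨?_, hp⟩, q, hSB _ hq, hpq⟩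
      rcases hp' with rfl | hp'
      · exact hra e
      · exact hp'
    obtain ⟨p, hp, q, hq, hpq⟩ := key ⟨s(u, v), huv⟩
    have := hab ⟨s(u, v), huv⟩
    rw [Sym2.eq_iff] at this
    rcases this with ⟨h, h'⟩ | ⟨h, h'⟩
    · exact ⟨p, h ▸ hp, q, h' ▸ hq, hpq⟩
    · exact ⟨q, h ▸ hq, p, h' ▸ hp, hpq.symm⟩

/-- Disjoint members of a finite family of compact sets are uniformly apart. -/
theorem exists_pos_le_dist {ι P : Type*} [Finite ι] [MetricSpace P] (X : ι → Set P)
    (hX : ∀ i, IsCompact (X i)) :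
    ∃ ε > 0, ∀ i j, Disjoint (X i) (X j) → ∀ x ∈ X i, ∀ y ∈ X j, ε ≤ dist x y := by
  have key : ∀ k : ι × ι, ∃ ε > 0, Disjoint (X k.1) (X k.2) →
      ∀ x ∈ X k.1, ∀ y ∈ X k.2, ε ≤ dist x y := by
    intro k
    by_cases hd : Disjoint (X k.1) (X k.2)
    · obtain ⟨ε, hε, h⟩ := hd.exists_thickenings (hX k.1) (hX k.2).isClosed
      refine ⟨ε, hε, fun _ x hx y hy => ?_⟩
      by_contra! hlt
      exact Set.disjoint_left.mp h (Metric.mem_thickening_iff.mpr ⟨x, hx, dist_comm x y ▸ hlt⟩)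
        (Metric.self_subset_thickening hε _ hy)
    · exact ⟨1, one_pos, fun h => absurd h hd⟩
  choose ε hε h using key
  obtain ⟨δ, hδ, hle⟩ : ∃ δ > 0, ∀ k, δ ≤ ε k := by
    rcases isEmpty_or_nonempty (ι × ι) with hι | hι
    · exact ⟨1, one_pos, fun k => isEmptyElim k⟩
    · obtain ⟨k, hk⟩ := Finite.exists_min ε
      exact ⟨ε k, hε k, hk⟩
  exact ⟨δ, hδ, fun i j hd x hx y hy => (hle (i, j)).trans (h (i, j) hd x hx y hy)⟩

/-- A finite planar graph is a minor of the grid. -/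
theorem exists_isModel_of_isPlanar {V : Type*} [Finite V] {G : SimpleGraph V} (hG : G.IsPlanar) :
    ∃ B, IsModel G B := by
  obtain ⟨D⟩ := hG
  have hex : ∀ e : G.edgeSet, ∃ u v, (e : Sym2 V) = s(u, v) ∧ D.arc e 0 = D.point u ∧
      D.arc e 1 = D.point v := by
    intro e
    have he := D.arc_ends e
    obtain ⟨u, v, huv⟩ : ∃ u v, (e : Sym2 V) = s(u, v) := by
      obtain ⟨e, _⟩ := e
      induction e with | _ u v
      exact ⟨u, v, rfl⟩
    rw [huv, Sym2.map_mk, Sym2.eq_iff] at he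
    rcases he with h | h
    · exact ⟨u, v, huv, h⟩
    · exact ⟨v, u, huv.trans Sym2.eq_swap, h⟩
  choose a b hab h0 h1 using hex
  let star' := star D.point D.arc a b
  let mid' := mid D.arc
  have hpoint : ∀ e t w, D.arc e t = D.point w → (t = 0 ∧ a e = w) ∨ (t = 1 ∧ b e = w) := by
    intro e t w h
    rcases D.arc_avoids e t w h with rfl | rfl
    · exact Or.inl ⟨rfl, D.point_injective ((h0 e).symm.trans h)⟩
    · exact Or.inr ⟨rfl, D.point_injective ((h1 e).symm.trans h)⟩
  -- Arcs meet vertices and other arcs only at parameters 0 and 1, where a point in the star of u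
  -- must be the point of u itself.
  have hend : ∀ e t u, (a e = u ∧ t ≤ lo) ∨ (b e = u ∧ hi ≤ t) → t = 0 ∨ t = 1 →
      D.arc e t = D.point u := by
    rintro e t u (⟨rfl, h⟩ | ⟨rfl, h⟩) (rfl | rfl)
    · exact h0 e
    · exact absurd h (lo_lt_hi.trans hi_lt_one).not_ge
    · exact absurd h (lo_pos.trans lo_lt_hi).not_ge
    · exact h1 e
  have hss : ∀ u v, u ≠ v → Disjoint (star' u) (star' v) := by
    intro u v huv
    rw [Set.disjoint_left]
    intro x hu hv
    rw [mem_star] at hu hv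
    rcases hu with rfl | ⟨e, t, ht, rfl⟩
    · rcases hv with h | ⟨e, t, ht, h⟩
      · exact huv (D.point_injective h)
      · refine huv (D.point_injective (h.symm.trans (hend e t v ht ?_)))
        exact D.arc_avoids e t u h
    · rcases hv with h | ⟨e', t', ht', h⟩
      · exact huv (D.point_injective ((hend e t u ht (D.arc_avoids e t v h)).symm.trans h))
      · by_cases hee : e' = e
        · subst hee
          have := D.arc_injective e' h
          subst this
          rcases ht with ⟨rfl, ht⟩ | ⟨rfl, ht⟩ <;> rcases ht' with ⟨h, ht'⟩ | ⟨h, ht'⟩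
          · exact huv h
          · exact lo_lt_hi.not_ge (ht'.trans ht)
          · exact lo_lt_hi.not_ge (ht.trans ht')
          · exact huv h
        · obtain ⟨h3, h4⟩ := D.arc_disjoint e' e t' t hee h
          exact huv (D.point_injective
            ((hend e t u ht h4).symm.trans (h.symm.trans (hend e' t' v ht' h3))))
  have hmid : ∀ t, t ∈ Set.Icc lo hi → ¬ (t = 0 ∨ t = 1) := by
    rintro t ht (rfl | rfl)
    · exact ht.1.not_gt lo_pos
    · exact ht.2.not_gt hi_lt_one
  have hms : ∀ e v, a e ≠ v → b e ≠ v → Disjoint (mid' e) (star' v) := by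
    intro e v hav hbv
    rw [Set.disjoint_left]
    rintro _ ⟨t, ht, rfl⟩ hv
    rw [mem_star] at hv
    rcases hv with h | ⟨e', t', ht', h⟩
    · exact hmid t ht (D.arc_avoids e t v h)
    · by_cases hee : e' = e
      · subst hee
        rcases ht' with ⟨h, -⟩ | ⟨h, -⟩
        · exact hav h
        · exact hbv h
      · exact hmid t ht (D.arc_disjoint e' e t' t hee h).2
  have hmm : ∀ e e', e ≠ e' → Disjoint (mid' e) (mid' e') := by
    intro e e' hee
    rw [Set.disjoint_left]
    rintro _ ⟨t, ht, rfl⟩ ⟨t', ht', h⟩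
    exact hmid t ht (D.arc_disjoint e e' t t' hee h.symm).1
  -- `ℝ × ℝ` carries the maximum norm, the one used by `near`.
  let Q : SimpleGraph.Plane → ℝ × ℝ := fun x => (x 0, x 1)
  have hQc : Continuous Q := by fun_prop
  have hQi : Function.Injective Q := by
    intro x y h
    ext i
    fin_cases i
    · exact congrArg Prod.fst h
    · exact congrArg Prod.snd h
  let X : V ⊕ G.edgeSet → Set (ℝ × ℝ) := Sum.elim (fun v => Q '' star' v) fun e => Q '' mid' e
  obtain ⟨ε, hε, hX⟩ := exists_pos_le_dist X (by
    rintro (v | e)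
    · exact (isCompact_star _ _ _ _ D.arc_continuous v).image hQc
    · exact (isCompact_mid _ D.arc_continuous e).image hQc)
  -- Scaling stretches the gap ε to 4, twice the radius of `near`.
  let φ : SimpleGraph.Plane → ℝ × ℝ := fun x => (4 / ε) • Q x
  have hφc : Continuous φ := by fun_prop
  have hφ : ∀ i j, Disjoint (X i) (X j) → ∀ x y, Q x ∈ X i → Q y ∈ X j → 4 ≤ dist (φ x) (φ y) := by
    intro i j hd x y hx hy
    have := hX i j hd _ hx _ hy
    have hpos : 0 < 4 / ε := by positivity
    rw [dist_smul₀, Real.norm_of_nonneg hpos.le]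
    calc (4 : ℝ) = 4 / ε * ε := by field_simp
      _ ≤ _ := mul_le_mul_of_nonneg_left this hpos.le
  have hstar : ∀ u, star (fun v => φ (D.point v)) (fun e t => φ (D.arc e t)) a b u = φ '' star' u := by
    intro u
    ext x
    simp only [star', mem_star, Set.mem_image]
    constructor
    · rintro (rfl | ⟨e, t, h, rfl⟩)
      · exact ⟨_, Or.inl rfl, rfl⟩
      · exact ⟨_, Or.inr ⟨e, t, h, rfl⟩, rfl⟩
    · rintro ⟨_, rfl | ⟨e, t, h, rfl⟩, rfl⟩
      · exact Or.inl rfl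
      · exact Or.inr ⟨e, t, h, rfl⟩
  have hmidφ : ∀ e, mid (fun e t => φ (D.arc e t)) e = φ '' mid' e := by
    intro e
    simp only [mid', mid, Set.image_image]
  refine exists_isModel_of_far G (fun v => φ (D.point v)) (fun e t => φ (D.arc e t)) a b hab
    (fun e => hφc.comp (D.arc_continuous e)) (fun e => by rw [h0]) (fun e => by rw [h1]) ?_ ?_ ?_
  · intro u v huv
    rw [hstar, hstar]
    rintro _ ⟨x, hx, rfl⟩ _ ⟨y, hy, rfl⟩
    exact hφ (Sum.inl u) (Sum.inl v) ((Set.disjoint_image_iff hQi).mpr (hss u v huv)) x y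
      (Set.mem_image_of_mem Q hx) (Set.mem_image_of_mem Q hy)
  · intro e v hav hbv
    rw [hstar, hmidφ]
    rintro _ ⟨x, hx, rfl⟩ _ ⟨y, hy, rfl⟩
    exact hφ (Sum.inr e) (Sum.inl v) ((Set.disjoint_image_iff hQi).mpr (hms e v hav hbv)) x y
      (Set.mem_image_of_mem Q hx) (Set.mem_image_of_mem Q hy)
  · intro e e' hee
    rw [hmidφ, hmidφ]
    rintro _ ⟨x, hx, rfl⟩ _ ⟨y, hy, rfl⟩
    exact hφ (Sum.inr e) (Sum.inr e') ((Set.disjoint_image_iff hQi).mpr (hmm e e' hee)) x y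
      (Set.mem_image_of_mem Q hx) (Set.mem_image_of_mem Q hy)

end Grid

theorem mainTheorem4 {V : Type u} [Fintype V] (G : SimpleGraph V) [DecidableRel G.Adj]
    (hplanar : G.IsPlanar) (hgirth : 4 ≤ G.egirth) (hdeg : 6 ≤ G.maxDegree) :
    SimpleGraph.GroupEdgeChoosable.{w, u} G (G.maxDegree + 1) := by
  obtain ⟨B, hB⟩ := Grid.exists_isModel_of_isPlanar hplanar
  refine SimpleGraph.groupEdgeChoosable_of_sparse G hdeg G.degree_le_maxDegree fun H hHG hne =>
    (hB.mono hHG).ncard_edgeSet_lt ?_ hne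
  intro a b c hab hbc hac
  classical
  -- A triangle of `H` is a 3-cycle of `G`, against the girth.
  obtain ⟨v, p, hp, hlen⟩ := SimpleGraph.is3Clique_iff_exists_cycle_length_three.mp
    ⟨{a, b, c}, SimpleGraph.is3Clique_triple_iff.mpr ⟨hHG hab, hHG hac, hHG hbc⟩⟩
  have := hgirth.trans (SimpleGraph.egirth_le_length hp)
  rw [hlen] at this
  exact absurd this (by decide)
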